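/- Let $d,n\ge 0$ be integers, let $\Omega\subset\mathbb{R}^d$ be compact, let $x_1,\dots,x_n\in\Omega$ be distinct points and let $y_1,\dots,y_n\in\mathbb{R}^d$. Let $K(x,z)=-|x-z|$ be the energy-distance kernel ($|\cdot|$ the Euclidean norm). For an $\mathbb{R}^d$-valued Borel measure $\Gamma$ on $\Omega$ put $(K\star\Gamma)(x)=\int_\Omega K(x,z)\,d\Gamma(z)\in\mathbb{R}^d$ and $$|\Gamma|_{TV}=\sup\Big\{\int_\Omega\langle f,d\Gamma\rangle : f\in C^0(\Omega,\mathbb{R}^d),\ \sup_{z\in\Omega}|f(z)|\le 1\Big\},$$ and let $\mathcal{M}_0$ be the set of those $\Gamma$ with $\Gamma(\Omega)=0\in\mathbb{R}^d$. Identify the space of constant vector fields $p$ with $\mathbb{R}^d$. Then the problem $$\min_{(\Gamma,p)\in\mathcal{M}_0\times\mathbb{R}^d}\ \sum_{i=1}^n|(K\star\Gamma)(x_i)+p-y_i|^2+|\Gamma|_{TV}$$ has a solution $(\Gamma,p)$ (the minimum is attained) for which $$\Gamma=\sum_{j=1}^m\alpha_j\delta_{z_j},\qquad m\le nd+d,\quad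 z_j\in\Omega,\quad \alpha_j\in\mathbb{R}^d,\quad \sum_{j=1}^m\alpha_j=0.$$ -/

import Mathlib

open MeasureTheory
open scoped ENNReal BoundedContinuousFunction

noncomputable section

namespace EnergyDistance

/-- The Euclidean space `ℝ^d`. -/
abbrev Space (d : ℕ) : Type := EuclideanSpace ℝ (Fin d)

/-- `ℝ^d`-valued (countably additive, finite) Borel measures on a set `Ω ⊆ ℝ^d`. -/
abbrev VMeas {d : ℕ} (Ω : Set (Space d)) : Type := VectorMeasure Ω (Space d)

/-- The energy-distance kernel `K(x, z) = -|x - z|`. -/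
def kernel {d : ℕ} (x z : Space d) : ℝ := -‖x - z‖

/-- The vector field `(K ⋆ Γ)(x) = ∫_Ω K(x, z) dΓ(z)`. -/
def conv {d : ℕ} {Ω : Set (Space d)} (Γ : VMeas Ω) (x : Space d) : Space d :=
  VectorMeasure.integral Γ (fun z : Ω => kernel x z) (ContinuousLinearMap.lsmul ℝ ℝ)

/-- The duality pairing `∫_Ω ⟨f(z), dΓ(z)⟩`. -/
def pairing {d : ℕ} {Ω : Set (Space d)} (f : Ω → Space d) (Γ : VMeas Ω) : ℝ :=
  VectorMeasure.integral Γ f (innerSL ℝ)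

/-- The total variation norm `|Γ|_TV`, by duality with the bounded continuous fields on `Ω`
under the uniform norm. -/
def tvNorm {d : ℕ} {Ω : Set (Space d)} (Γ : VMeas Ω) : ℝ≥0∞ :=
  ⨆ (f : Ω →ᵇ Space d) (_ : ‖f‖ ≤ 1), ENNReal.ofReal (pairing f Γ)

/-- The measures with zero total mass, `Γ(Ω) = 0 ∈ ℝ^d`. -/
def zeroMass {d : ℕ} (Ω : Set (Space d)) : Set (VMeas Ω) := {Γ | Γ Set.univ = 0}

/-- The soft interpolation functional `∑ᵢ |(K ⋆ Γ)(xᵢ) + p - yᵢ|² + |Γ|_TV`, where `p ∈ ℝ^d` is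
identified with the constant field equal to `p`. -/
def objective {d n : ℕ} {Ω : Set (Space d)} (x : Fin n → Ω) (y : Fin n → Space d)
    (q : VMeas Ω × Space d) : ℝ≥0∞ :=
  ENNReal.ofReal (∑ i, ‖conv q.1 (x i) + q.2 - y i‖ ^ 2) + tvNorm q.1

/-- `(Γ, p)` solves the soft interpolation problem: it minimizes the functional among all pairs of
a zero-mass measure and a constant field. -/
def IsSolution {d n : ℕ} {Ω : Set (Space d)} (x : Fin n → Ω) (y : Fin n → Space d)
    (Γ : VMeas Ω) (p : Space d) : Prop :=
  Γ ∈ zeroMass Ω ∧ IsMinOn (objective x y) (zeroMass Ω ×ˢ Set.univ) (Γ, p)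

/-- An `ℝ^d`-valued measure has finite variation, so that every bounded continuous function is
integrable against it and the integrals above are genuine. -/
theorem variation_univ_lt_top {d : ℕ} {Ω : Set (Space d)} (Γ : VMeas Ω) :
    Γ.variation Set.univ < ∞ := by
  let c : Fin d → SignedMeasure Ω := fun k =>
    Γ.mapRange (EuclideanSpace.proj k : Space d →L[ℝ] ℝ).toLinearMap.toAddMonoidHom
      (EuclideanSpace.proj k : Space d →L[ℝ] ℝ).continuous
  have h : Γ.variation ≤ ∑ k, (c k).variation := by
    apply VectorMeasure.variation_le_of_forall_enorm_le
    intro s _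
    have h1 : Γ s = ∑ k, EuclideanSpace.single k (c k s) := by
      ext j
      have h2 : ∀ k, c k s = Γ s k := fun k => rfl
      simp [h2, Pi.single_apply]
    rw [Measure.coe_finsetSum, Finset.sum_apply, h1]
    refine (enorm_sum_le _ _).trans (Finset.sum_le_sum fun k _ => ?_)
    refine le_trans (le_of_eq ?_) (VectorMeasure.enorm_measure_le_variation (c k) s)
    simp [enorm_eq_nnnorm]
  refine (h Set.univ).trans_lt ?_
  rw [Measure.coe_finsetSum, Finset.sum_apply]
  refine ENNReal.sum_lt_top.2 fun k _ => ?_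
  rw [← SignedMeasure.totalVariation_eq_variation]
  exact measure_lt_top _ _

end EnergyDistance

end

/-! The data term and the constraint see `Γ` only through (n+1)d real numbers: its moments against
the n functions K(x_i, ·) and the constant 1. By Hahn-Banach these moments lie in the closure of
|Γ|_TV times the convex hull of the moments of Dirac masses with coefficient in the unit ball
(`moments_mem_closure_smul_convexHull`). A conic Carathéodory theorem that does not increase the
total mass brings points of the dilated hull down to N = (n+1)d Diracs, and compactness of Ω removes
the closure (`exists_sum_dirac_moments_eq`). Asking for total mass at most, rather than equal to,
|Γ|_TV is what avoids an extra atom.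

Hence every `Γ` of finite norm can be replaced by N Diracs at no greater cost. For n > 0 the problem
over N atoms is continuous with compact sublevel sets, so its minimum is attained
(`exists_discreteObjective_le`). -/

/-- **Carathéodory's theorem for cones**, with control of the total mass. -/
theorem Finset.exists_conic_combination_card_le_finrank {E : Type*} [AddCommGroup E] [Module ℝ E]
    [FiniteDimensional ℝ E] (s : Finset E) (a : E → ℝ) (ha : ∀ v ∈ s, 0 ≤ a v) :
    ∃ t ⊆ s, ∃ b : E → ℝ, t.card ≤ Module.finrank ℝ E ∧ (∀ v ∈ t, 0 ≤ b v) ∧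
      ∑ v ∈ t, b v • v = ∑ v ∈ s, a v • v ∧ ∑ v ∈ t, b v ≤ ∑ v ∈ s, a v := by
  classical
  induction s using Finset.strongInduction generalizing a with
  | H s ih =>
    by_cases hs : s.card ≤ Module.finrank ℝ E
    · exact ⟨s, subset_rfl, a, hs, ha, rfl, le_rfl⟩
    obtain ⟨c, hc0, hcsum, hcpos⟩ : ∃ c : E → ℝ, ∑ v ∈ s, c v • v = 0 ∧ 0 ≤ ∑ v ∈ s, c v ∧
        ∃ v ∈ s, 0 < c v := by
      obtain ⟨c, hc0, w, hw, hcw⟩ :=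
        Module.exists_nontrivial_relation_of_finrank_lt_card (R := ℝ) (not_le.1 hs)
      -- The sign of the relation is chosen so that subtracting a nonnegative multiple of it cannot
      -- raise the total mass.
      wlog hsum : 0 ≤ ∑ v ∈ s, c v generalizing c
      · refine this (-c) ?_ (by simpa using hcw) ?_
        · simp [hc0]
        · simp only [Pi.neg_apply, Finset.sum_neg_distrib]
          linarith
      refine ⟨c, hc0, hsum, ?_⟩
      by_contra! hneg
      have h0 : ∑ v ∈ s, c v = 0 := le_antisymm (Finset.sum_nonpos hneg) hsum
      exact hcw ((Finset.sum_eq_zero_iff_of_nonpos hneg).1 h0 w hw)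
    obtain ⟨w, hw, hmin⟩ := Finset.exists_min_image (s.filter fun v => 0 < c v)
      (fun v => a v / c v) (by obtain ⟨v, hv, h⟩ := hcpos; exact ⟨v, by simp [hv, h]⟩)
    simp only [Finset.mem_filter] at hw hmin
    obtain ⟨hws, hcw⟩ := hw
    -- The smallest ratio is the largest step that keeps all coefficients nonnegative; it makes that
    -- of `w` vanish.
    set r := a w / c w with hr
    have hr0 : 0 ≤ r := div_nonneg (ha w hws) hcw.le
    have hnn : ∀ v ∈ s, 0 ≤ a v - r * c v := by
      intro v hv
      rcases lt_or_ge 0 (c v) with h | h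
      · have := (le_div_iff₀ h).1 (hmin v ⟨hv, h⟩)
        linarith
      · nlinarith [ha v hv]
    have hwz : a w - r * c w = 0 := by rw [hr, div_mul_cancel₀ _ hcw.ne', sub_self]
    obtain ⟨t, hts, b, hb1, hb2, hb3, hb4⟩ := ih (s.erase w) (Finset.erase_ssubset hws)
      (fun v => a v - r * c v) (fun v hv => hnn v (Finset.mem_of_mem_erase hv))
    refine ⟨t, hts.trans (Finset.erase_subset _ _), b, hb1, hb2, ?_, ?_⟩
    · rw [hb3, Finset.sum_erase _ (by simp [hwz])]
      simp only [sub_smul, Finset.sum_sub_distrib, mul_smul, ← Finset.smul_sum, hc0, smul_zero,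
        sub_zero]
    · refine hb4.trans ?_
      rw [Finset.sum_erase (f := fun v => a v - r * c v) s hwz, Finset.sum_sub_distrib, ← Finset.mul_sum]
      nlinarith

/-- A point of the `r`-fold dilate of a convex hull is a conic combination, of total mass at most
`r`, of at most `finrank` many points. -/
theorem exists_conic_combination_of_mem_smul_convexHull {E : Type*} [AddCommGroup E] [Module ℝ E]
    [FiniteDimensional ℝ E] {A : Set E} {r : ℝ} (hr : 0 ≤ r) {v : E} (hv : v ∈ convexHull ℝ A) :
    ∃ t : Finset E, (t : Set E) ⊆ A ∧ ∃ b : E → ℝ, t.card ≤ Module.finrank ℝ E ∧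
      (∀ w ∈ t, 0 ≤ b w) ∧ ∑ w ∈ t, b w • w = r • v ∧ ∑ w ∈ t, b w ≤ r := by
  rw [convexHull_eq_union_convexHull_finite_subsets] at hv
  simp only [Set.mem_iUnion] at hv
  obtain ⟨s, hsA, hv⟩ := hv
  obtain ⟨a, ha, ha1, rfl⟩ := Finset.mem_convexHull'.1 hv
  obtain ⟨t, hts, b, h1, h2, h3, h4⟩ := s.exists_conic_combination_card_le_finrank
    (fun w => r * a w) (fun w hw => mul_nonneg hr (ha w hw))
  refine ⟨t, fun w hw => hsA (hts hw), b, h1, h2, ?_, ?_⟩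
  · rw [h3, Finset.smul_sum]
    simp [mul_smul]
  · rwa [← Finset.mul_sum, ha1, mul_one] at h4

/-! ### Pairings and total variation of vector measures -/

/-- Integrating the field `z ↦ k z • c` against a vector measure through the inner product. -/
theorem MeasureTheory.VectorMeasure.integral_smul_const_innerSL {X F : Type*} [MeasurableSpace X]
    [NormedAddCommGroup F] [InnerProductSpace ℝ F] [CompleteSpace F] (μ : VectorMeasure X F)
    {k : X → ℝ} (hk : μ.Integrable k) (c : F) :
    VectorMeasure.integral μ (fun z => k z • c) (innerSL ℝ) =
      inner ℝ c (VectorMeasure.integral μ k (ContinuousLinearMap.lsmul ℝ ℝ)) := by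
  have hint : ∀ f : X → ℝ, μ.Integrable f → μ.Integrable fun z => f z • c :=
    fun f hf => hf.smul_const c
  -- Both sides are additive and L¹-continuous in `k`, so indicators suffice.
  refine Integrable.induction (μ := μ.variation) (fun k : X → ℝ =>
    VectorMeasure.integral μ (fun z => k z • c) (innerSL ℝ) =
      inner ℝ c (VectorMeasure.integral μ k (ContinuousLinearMap.lsmul ℝ ℝ))) ?_ ?_ ?_ ?_ hk
  · intro r s hs hfin
    have h1 : (fun z => s.indicator (fun _ => r) z • c) = s.indicator fun _ => r • c := by
      ext z
      by_cases hz : z ∈ s <;> simp [hz]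
    rw [h1, VectorMeasure.integral_eq_setToFun, VectorMeasure.integral_eq_setToFun,
      setToFun_indicator_const _ hs hfin.ne, setToFun_indicator_const _ hs hfin.ne]
    change inner ℝ (r • c) (μ s) = inner ℝ c (r • μ s)
    rw [real_inner_smul_left, real_inner_smul_right]
  · intro f g _ hf hg hf' hg'
    simp only [Pi.add_apply, add_smul]
    rw [VectorMeasure.integral_fun_add (hint f hf) (hint g hg),
      VectorMeasure.integral_add hf hg, inner_add_right, hf', hg']
  · refine isClosed_eq ?_ ?_
    · have h := (VectorMeasure.continuous_integral (μ := μ) (B := innerSL (E := F) ℝ)).comp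
        (((ContinuousLinearMap.id ℝ ℝ).smulRight c).compLpL 1 μ.variation).continuous
      refine h.congr fun f => VectorMeasure.integral_congr_ae ?_
      filter_upwards [ContinuousLinearMap.coeFn_compLp
        ((ContinuousLinearMap.id ℝ ℝ).smulRight c) f] with z hz
      exact hz
    · exact continuous_const.inner VectorMeasure.continuous_integral
  · intro f g hfg _ hf
    have h1 : (fun z => f z • c) =ᵐ[μ.variation] fun z => g z • c := by
      filter_upwards [hfg] with z hz
      rw [hz]
    rw [← VectorMeasure.integral_congr_ae h1, hf, VectorMeasure.integral_congr_ae hfg]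

namespace EnergyDistance

variable {d : ℕ} {Ω : Set (Space d)}

theorem isFiniteMeasure_variation (Γ : VMeas Ω) : IsFiniteMeasure Γ.variation :=
  ⟨variation_univ_lt_top Γ⟩

theorem integrable_of_continuous [CompactSpace Ω] {F : Type*} [NormedAddCommGroup F]
    (Γ : VMeas Ω) {f : Ω → F} (hf : Continuous f) : Γ.Integrable f := by
  have := isFiniteMeasure_variation Γ
  exact hf.integrable_of_hasCompactSupport (HasCompactSupport.of_compactSpace f)

/-- The pairing is bounded by the product of the uniform norm and the total variation norm. -/
theorem pairing_le (Γ : VMeas Ω) (hΓ : tvNorm Γ ≠ ∞) (f : Ω →ᵇ Space d) :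
    pairing f Γ ≤ ‖f‖ * (tvNorm Γ).toReal := by
  rcases eq_or_ne f 0 with rfl | hf
  · have h0 : pairing (0 : Ω →ᵇ Space d) Γ = 0 := VectorMeasure.integral_zero
    exact h0.le.trans (by positivity)
  have hf' : 0 < ‖f‖ := norm_pos_iff.2 hf
  have h1 : ENNReal.ofReal (pairing (‖f‖⁻¹ • f : Ω →ᵇ Space d) Γ) ≤ tvNorm Γ :=
    le_iSup₂_of_le (‖f‖⁻¹ • f) (by rw [norm_smul, norm_inv, norm_norm, inv_mul_cancel₀ hf'.ne'])
      le_rfl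
  have h2 : pairing (‖f‖⁻¹ • f : Ω →ᵇ Space d) Γ = ‖f‖⁻¹ * pairing f Γ := by
    simp only [pairing, BoundedContinuousFunction.coe_smul]
    exact VectorMeasure.integral_fun_smul Γ _ _ _
  have h3 := (ENNReal.ofReal_le_iff_le_toReal hΓ).1 h1
  rwa [h2, inv_mul_le_iff₀ hf'] at h3

theorem pairing_sum_dirac {ι : Type*} [Fintype ι] (f : Ω → Space d) (z : ι → Ω)
    (α : ι → Space d) :
    pairing f (∑ j, VectorMeasure.dirac (z j) (α j)) = ∑ j, inner ℝ (f (z j)) (α j) := by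
  rw [pairing, VectorMeasure.integral_finsetSum_vectorMeasure]
  · simp only [VectorMeasure.integral_dirac]
    rfl
  · intro j _
    rw [VectorMeasure.Integrable, VectorMeasure.variation_dirac]
    exact (integrable_dirac enorm_lt_top).smul_measure enorm_ne_top

theorem conv_sum_dirac {ι : Type*} [Fintype ι] (z : ι → Ω) (α : ι → Space d) (x : Space d) :
    conv (∑ j, VectorMeasure.dirac (z j) (α j)) x = ∑ j, kernel x (z j) • α j := by
  rw [conv, VectorMeasure.integral_finsetSum_vectorMeasure]
  · simp
  · intro j _
    rw [VectorMeasure.Integrable, VectorMeasure.variation_dirac]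
    exact (integrable_dirac enorm_lt_top).smul_measure enorm_ne_top

/-- Only an inequality, since the points `z j` may coincide and their coefficients cancel; the proof
needs no more. -/
theorem tvNorm_sum_dirac_le {ι : Type*} [Fintype ι] (z : ι → Ω) (α : ι → Space d) :
    tvNorm (∑ j, VectorMeasure.dirac (z j) (α j)) ≤ ENNReal.ofReal (∑ j, ‖α j‖) := by
  refine iSup₂_le fun f hf => ENNReal.ofReal_le_ofReal ?_
  rw [pairing_sum_dirac]
  refine Finset.sum_le_sum fun j _ => (real_inner_le_norm _ _).trans ?_
  exact mul_le_of_le_one_left (norm_nonneg _) ((f.norm_coe_le_norm _).trans hf)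

/-! ### Reduction of moments to finitely many Diracs -/

/-- The vector of the moments of `Γ` against finitely many scalar functions. -/
noncomputable def moments {ι : Type*} (k : ι → Ω → ℝ) (Γ : VMeas Ω) (i : ι) : Space d :=
  VectorMeasure.integral Γ (k i) (ContinuousLinearMap.lsmul ℝ ℝ)

/-- The moments of the Dirac masses with coefficient in the unit ball. -/
def diracMoments {ι : Type*} (k : ι → Ω → ℝ) : Set (ι → Space d) :=
  (fun q : Space d × Ω => fun i => k i q.2 • q.1) '' (Metric.closedBall 0 1 ×ˢ Set.univ)

open scoped Pointwise in
/-- The moments of a measure lie in the closed convex hull of the moments of the Dirac masses,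
dilated by the total variation norm. -/
theorem moments_mem_closure_smul_convexHull [CompactSpace Ω] [Nonempty Ω] {ι : Type*} [Fintype ι]
    {k : ι → Ω → ℝ} (hk : ∀ i, Continuous (k i)) (Γ : VMeas Ω) (hΓ : tvNorm Γ ≠ ∞) :
    moments k Γ ∈ closure ((tvNorm Γ).toReal • convexHull ℝ (diracMoments k)) := by
  classical
  set t := (tvNorm Γ).toReal
  have ht : 0 ≤ t := ENNReal.toReal_nonneg
  by_contra hmem
  obtain ⟨l, u, hl, hu⟩ := geometric_hahn_banach_closed_point
    ((convex_convexHull ℝ (diracMoments k)).smul t).closure isClosed_closure hmem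
  have hlsum : ∀ w : ι → Space d, l w = ∑ i, l (Pi.single i (w i)) := by
    intro w
    rw [← map_sum, Finset.univ_sum_single]
  let c : ι → Space d := fun i =>
    (InnerProductSpace.toDual ℝ (Space d)).symm
      (l.comp (ContinuousLinearMap.single ℝ (fun _ : ι => Space d) i))
  have hc : ∀ i w, inner ℝ (c i) w = l (Pi.single i w) := by
    intro i w
    simp [c, InnerProductSpace.toDual_symm_apply]
  -- The separating functional `l`, written through the vectors `c i`, becomes a continuous test
  -- field on Ω.
  let f : C(Ω, Space d) := ⟨fun z => ∑ i, k i z • c i,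
    continuous_finsetSum _ fun i _ => (hk i).smul continuous_const⟩
  have hpair : pairing (BoundedContinuousFunction.mkOfCompact f) Γ = l (moments k Γ) := by
    change VectorMeasure.integral Γ (fun z => ∑ i, k i z • c i) (innerSL ℝ) = _
    rw [VectorMeasure.integral_finsetSum, hlsum]
    · refine Finset.sum_congr rfl fun i _ => ?_
      rw [VectorMeasure.integral_smul_const_innerSL Γ (integrable_of_continuous Γ (hk i)), hc]
      rfl
    · exact fun i _ => integrable_of_continuous Γ ((hk i).smul continuous_const)
  have hdirac : ∀ (z : Ω) (α : Space d), ‖α‖ ≤ 1 → t * inner ℝ (f z) α < u := by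
    intro z α hα
    have h := hl (t • fun i => k i z • α)
      (subset_closure (Set.smul_mem_smul_set
        (subset_convexHull ℝ _ ⟨(α, z), by simpa using hα, rfl⟩)))
    rw [map_smul, hlsum] at h
    refine lt_of_eq_of_lt ?_ h
    simp [f, sum_inner, ← hc, real_inner_smul_left, real_inner_smul_right]
  have hnorm : ∀ z, t * ‖f z‖ ≤ u := by
    intro z
    rcases eq_or_ne (f z) 0 with h0 | h0
    · simpa [h0] using (hdirac z 0 (by simp)).le
    -- The best unit coefficient at `z` is the direction of `f z`.
    have h := hdirac z (‖f z‖⁻¹ • f z)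
      (by rw [norm_smul, norm_inv, norm_norm, inv_mul_cancel₀ (norm_ne_zero_iff.2 h0)])
    rw [real_inner_smul_right, real_inner_self_eq_norm_sq, pow_two,
      inv_mul_cancel_left₀ (norm_ne_zero_iff.2 h0)] at h
    exact h.le
  obtain ⟨z, -, hz⟩ := isCompact_univ.exists_isMaxOn (Set.univ_nonempty (α := Ω))
    f.continuous.norm.continuousOn
  have hfz : ‖BoundedContinuousFunction.mkOfCompact f‖ ≤ ‖f z‖ :=
    (BoundedContinuousFunction.norm_le (norm_nonneg _)).2 fun w => hz (Set.mem_univ w)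
  -- Contradiction: u < l(moments) = ⟨f, Γ⟩ ≤ ‖f‖ t ≤ t |f(z)| ≤ u.
  have h1 := pairing_le Γ hΓ (BoundedContinuousFunction.mkOfCompact f)
  rw [hpair] at h1
  have h2 := mul_le_mul_of_nonneg_right hfz ht
  have h3 := hnorm z
  linarith

open scoped Pointwise in
/-- Dilated convex combinations of moments of Dirac masses are moments of combinations of few Dirac
masses. -/
theorem exists_sum_of_mem_smul_convexHull [Nonempty Ω] {ι : Type*} [Fintype ι] {k : ι → Ω → ℝ}
    {r : ℝ} (hr : 0 ≤ r) {N : ℕ} (hN : Fintype.card ι * d = N) {v : ι → Space d}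
    (hv : v ∈ r • convexHull ℝ (diracMoments k)) :
    ∃ (z : Fin N → Ω) (α : Fin N → Space d),
      (fun i => ∑ j, k i (z j) • α j) = v ∧ ∑ j, ‖α j‖ ≤ r := by
  obtain ⟨v, hv, rfl⟩ := hv
  obtain ⟨t, htA, b, htcard, hb, hsum, hmass⟩ :=
    exists_conic_combination_of_mem_smul_convexHull hr hv
  have hfin : Module.finrank ℝ (ι → Space d) = N := by
    simp [Module.finrank_pi_fintype, hN]
  obtain ⟨e⟩ : Nonempty (t ↪ Fin N) :=
    Function.Embedding.nonempty_of_card_le (by simpa [hfin] using htcard)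
  choose q hq hqv using fun w : t => htA w.2
  have hq1 : ∀ w, ‖(q w).1‖ ≤ 1 := fun w => by simpa using (hq w).1
  -- Unused indices are padded with an arbitrary point and coefficient zero.
  let z : Fin N → Ω := Function.extend e (fun w => (q w).2) fun _ => Classical.arbitrary Ω
  let α : Fin N → Space d := Function.extend e (fun w => b w • (q w).1) 0
  have hz : ∀ w, z (e w) = (q w).2 := fun w => e.injective.extend_apply _ _ w
  have hα : ∀ w, α (e w) = b w • (q w).1 := fun w => e.injective.extend_apply _ _ w
  have hα0 : ∀ j, j ∉ Set.range e → α j = 0 := fun j hj => Function.extend_apply' _ _ j hj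
  refine ⟨z, α, funext fun i => ?_, ?_⟩
  · change _ = (r • v) i
    rw [← hsum, Finset.sum_apply, ← Finset.sum_coe_sort t]
    refine (Fintype.sum_of_injective e e.injective (fun w : t => (b w • (w : ι → Space d)) i)
      (fun j => k i (z j) • α j) (fun j hj => ?_) fun w => ?_).symm
    · simp only [hα0 j hj, smul_zero]
    · simp only [hz, hα, Pi.smul_apply]
      rw [← congrFun (hqv w) i, smul_comm]
  · refine le_trans (le_of_eq ?_) (le_trans (Finset.sum_le_sum (s := Finset.univ)
      (f := fun w : t => b w * ‖(q w).1‖) (g := fun w : t => b w) fun w _ =>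
        mul_le_of_le_one_right (hb w w.2) (hq1 w)) ((Finset.sum_coe_sort t b).trans_le hmass))
    refine (Fintype.sum_of_injective e e.injective (fun w : t => b w * ‖(q w).1‖)
      (fun j => ‖α j‖) (fun j hj => ?_) fun w => ?_).symm
    · simp only [hα0 j hj, norm_zero]
    · simp only [hα, norm_smul, Real.norm_of_nonneg (hb w w.2)]

/-- Every measure of finite total variation has the same moments as a combination of few Dirac
masses, whose total mass is at most the total variation norm. -/
theorem exists_sum_dirac_moments_eq [CompactSpace Ω] [Nonempty Ω] {ι : Type*} [Fintype ι]
    {k : ι → Ω → ℝ} (hk : ∀ i, Continuous (k i)) (Γ : VMeas Ω) (hΓ : tvNorm Γ ≠ ∞) {N : ℕ}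
    (hN : Fintype.card ι * d = N) :
    ∃ (z : Fin N → Ω) (α : Fin N → Space d),
      (∀ i, ∑ j, k i (z j) • α j = moments k Γ i) ∧ ∑ j, ‖α j‖ ≤ (tvNorm Γ).toReal := by
  set r := (tvNorm Γ).toReal
  have hr : 0 ≤ r := ENNReal.toReal_nonneg
  let B : Set (Fin N → Space d) := {α | ∑ j, ‖α j‖ ≤ r}
  have hB : IsCompact B := by
    refine (isCompact_closedBall (0 : Fin N → Space d) r).of_isClosed_subset
      (isClosed_le (by fun_prop) continuous_const) fun α hα => ?_
    rw [mem_closedBall_zero_iff, pi_norm_le_iff_of_nonneg hr]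
    exact fun j => (Finset.single_le_sum (f := fun j => ‖α j‖)
      (fun _ _ => norm_nonneg _) (Finset.mem_univ j)).trans hα
  have hcont : Continuous fun q : (Fin N → Space d) × (Fin N → Ω) =>
      fun i => ∑ j, k i (q.2 j) • q.1 j := by
    have h := fun i j => (hk i).comp ((continuous_apply (A := fun _ : Fin N => Ω) j).comp
      (continuous_snd (X := Fin N → Space d) (Y := Fin N → Ω)))
    simp only [Function.comp_def] at h
    fun_prop
  -- The moments of N Diracs of total mass at most `r` form a compact set, so it absorbs the
  -- closure.
  have hclosed := ((hB.prod (isCompact_univ (X := Fin N → Ω))).image hcont).isClosed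
  have hmem := closure_minimal (fun v hv => ?_) hclosed
    (moments_mem_closure_smul_convexHull hk Γ hΓ)
  · obtain ⟨⟨α, z⟩, ⟨hα, -⟩, h⟩ := hmem
    exact ⟨z, α, congrFun h, hα⟩
  · obtain ⟨z, α, h, hα⟩ := exists_sum_of_mem_smul_convexHull hr hN hv
    exact ⟨(α, z), ⟨hα, Set.mem_univ _⟩, h⟩

/-! ### Existence of a minimizer among N Diracs -/

/-- The functional restricted to combinations of `N` Dirac masses. -/
noncomputable def discreteObjective {n N : ℕ} (k : Fin n → Ω → ℝ) (y : Fin n → Space d)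
    (q : (Fin N → Space d) × (Fin N → Ω) × Space d) : ℝ :=
  ∑ i, ‖∑ j, k i (q.2.1 j) • q.1 j + q.2.2 - y i‖ ^ 2 + ∑ j, ‖q.1 j‖

/-- The norm term bounds the coefficients, Ω is compact, and a single data point then bounds `p`;
this is where n > 0 enters. -/
theorem exists_discreteObjective_le [CompactSpace Ω] [Nonempty Ω] {n N : ℕ} (hn : 0 < n)
    {k : Fin n → Ω → ℝ} (hk : ∀ i, Continuous (k i)) (y : Fin n → Space d) :
    ∃ (α : Fin N → Space d) (z : Fin N → Ω) (p : Space d), ∑ j, α j = 0 ∧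
      ∀ q : (Fin N → Space d) × (Fin N → Ω) × Space d, ∑ j, q.1 j = 0 →
        discreteObjective k y (α, z, p) ≤ discreteObjective k y q := by
  let i₀ : Fin n := ⟨0, hn⟩
  obtain ⟨C, hC⟩ := isCompact_univ.exists_bound_of_continuousOn (hk i₀).continuousOn
  have hC0 : 0 ≤ C := (norm_nonneg _).trans (hC (Classical.arbitrary Ω) (Set.mem_univ _))
  let q₀ : (Fin N → Space d) × (Fin N → Ω) × Space d := (0, fun _ => Classical.arbitrary Ω, 0)
  set Y : ℝ := discreteObjective k y q₀ with hY
  have hY0 : 0 ≤ Y := by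
    rw [hY, discreteObjective]
    positivity
  -- Bounds |p| below level `Y`: the residual at `i₀` is at most Y + 1 (its square is at most Y),
  -- the kernel sum at most C Y.
  set R : ℝ := Y + 1 + C * Y + ‖y i₀‖
  have hR0 : 0 ≤ R := by positivity
  have hcont : Continuous (discreteObjective (N := N) k y) := by
    have h := fun i j => (hk i).comp ((continuous_apply (A := fun _ : Fin N => Ω) j).comp
      (continuous_fst.comp (continuous_snd (X := Fin N → Space d) (Y := (Fin N → Ω) × Space d))))
    simp only [Function.comp_def] at h
    unfold discreteObjective
    fun_prop
  let S : Set ((Fin N → Space d) × (Fin N → Ω) × Space d) := {q | ∑ j, q.1 j = 0}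
  have hS : IsClosed S := isClosed_eq (by fun_prop) continuous_const
  let K := (Metric.closedBall (0 : Fin N → Space d) Y) ×ˢ
    ((Set.univ : Set (Fin N → Ω)) ×ˢ Metric.closedBall (0 : Space d) R)
  have hK : IsCompact K :=
    (isCompact_closedBall _ _).prod (isCompact_univ.prod (isCompact_closedBall _ _))
  have hq₀ : q₀ ∈ K ∩ S := by
    refine ⟨⟨?_, Set.mem_univ _, ?_⟩, ?_⟩
    · simpa [q₀] using hY0
    · simpa [q₀] using hR0
    · simp [q₀, S]
  obtain ⟨q₁, hq₁, hmin⟩ := (hK.inter_right hS).exists_isMinOn ⟨q₀, hq₀⟩ hcont.continuousOn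
  refine ⟨q₁.1, q₁.2.1, q₁.2.2, hq₁.2, fun q hq => ?_⟩
  rcases le_or_gt Y (discreteObjective k y q) with h | h
  · exact (hmin hq₀).trans h
  refine hmin ⟨⟨?_, Set.mem_univ _, ?_⟩, hq⟩
  all_goals
    have h1 : ∑ j, ‖q.1 j‖ ≤ Y := by
      refine le_trans ?_ h.le
      exact le_add_of_nonneg_left (by positivity)
  · rw [mem_closedBall_zero_iff, pi_norm_le_iff_of_nonneg hY0]
    exact fun j => (Finset.single_le_sum (f := fun j => ‖q.1 j‖)
      (fun _ _ => norm_nonneg _) (Finset.mem_univ j)).trans h1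
  · rw [mem_closedBall_zero_iff]
    set w := ∑ j, k i₀ (q.2.1 j) • q.1 j with hw
    have h2 : ‖w‖ ≤ C * Y := by
      refine (norm_sum_le _ _).trans (le_trans (Finset.sum_le_sum fun j _ => ?_)
        ((Finset.mul_sum _ (fun j => ‖q.1 j‖) C).symm.le.trans (mul_le_mul_of_nonneg_left h1 hC0)))
      rw [norm_smul]
      exact mul_le_mul_of_nonneg_right (hC _ (Set.mem_univ _)) (norm_nonneg _)
    have h3 : ‖w + q.2.2 - y i₀‖ ^ 2 ≤ Y := by
      refine le_trans ?_ h.le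
      refine le_trans ?_ (le_add_of_nonneg_right (by positivity))
      exact Finset.single_le_sum (f := fun i => ‖∑ j, k i (q.2.1 j) • q.1 j + q.2.2 - y i‖ ^ 2)
        (fun _ _ => by positivity) (Finset.mem_univ i₀)
    have h4 : ‖w + q.2.2 - y i₀‖ ≤ Y + 1 := by nlinarith [norm_nonneg (w + q.2.2 - y i₀)]
    calc ‖q.2.2‖ = ‖(w + q.2.2 - y i₀) - w + y i₀‖ := by congr 1; abel
      _ ≤ ‖w + q.2.2 - y i₀‖ + ‖w‖ + ‖y i₀‖ :=
        (norm_add_le _ _).trans (add_le_add_left (norm_sub_le _ _) _)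
      _ ≤ R := by
        simp only [R]
        linarith

theorem continuous_kernel (x : Space d) : Continuous fun z : Ω => kernel x z := by
  unfold kernel
  fun_prop

end EnergyDistance


/-! ### From the discrete problem to measures -/

namespace EnergyDistance

variable {d n N : ℕ} {Ω : Set (Space d)}

theorem objective_sum_dirac_le (x : Fin n → Ω) (y : Fin n → Space d) (z : Fin N → Ω)
    (α : Fin N → Space d) (p : Space d) :
    objective x y (∑ j, VectorMeasure.dirac (z j) (α j), p) ≤
      ENNReal.ofReal (discreteObjective (fun i (w : Ω) => kernel (d := d) (x i) w) y (α, z, p)) := by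
  rw [discreteObjective, ENNReal.ofReal_add (Finset.sum_nonneg fun _ _ => sq_nonneg _)
    (Finset.sum_nonneg fun _ _ => norm_nonneg _), objective]
  simp only [conv_sum_dirac]
  exact add_le_add_right (tvNorm_sum_dirac_le z α) _

theorem discreteObjective_le_objective (x : Fin n → Ω) (y : Fin n → Space d) {z : Fin N → Ω}
    {α : Fin N → Space d} {p : Space d} {Γ : VMeas Ω}
    (hconv : ∀ i, ∑ j, kernel (d := d) (x i) (z j) • α j = conv Γ (x i))
    (hmass : ENNReal.ofReal (∑ j, ‖α j‖) ≤ tvNorm Γ) :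
    ENNReal.ofReal (discreteObjective (fun i (w : Ω) => kernel (d := d) (x i) w) y (α, z, p)) ≤
      objective x y (Γ, p) := by
  rw [discreteObjective, ENNReal.ofReal_add (Finset.sum_nonneg fun _ _ => sq_nonneg _)
    (Finset.sum_nonneg fun _ _ => norm_nonneg _), objective]
  simp only [hconv]
  exact add_le_add_right hmass _

end EnergyDistance

open EnergyDistance in
theorem exists_isSolution_sum_dirac {d n N : ℕ} (hn : 0 < n) (hN : n * d + d = N)
    {Ω : Set (Space d)} [CompactSpace Ω] (x : Fin n → Ω) (y : Fin n → Space d) :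
    ∃ (Γ : VMeas Ω) (p : Space d), IsSolution x y Γ p ∧
      ∃ (z : Fin N → Ω) (α : Fin N → Space d),
        Γ = ∑ j, VectorMeasure.dirac (z j) (α j) ∧ ∑ j, α j = 0 := by
  have : Nonempty Ω := ⟨x ⟨0, hn⟩⟩
  let k₀ : Fin n → Ω → ℝ := fun i w => kernel (d := d) (x i) w
  have hk : ∀ i, Continuous (k₀ i) := fun i => continuous_kernel _
  obtain ⟨α, z, p, hα, hmin⟩ :=
    exists_discreteObjective_le (N := N) hn hk y
  refine ⟨∑ j, VectorMeasure.dirac (z j) (α j), p, ⟨?_, ?_⟩, z, α, rfl, hα⟩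
  · simpa [zeroMass] using hα
  rintro ⟨Γ, r⟩ ⟨hΓ0, -⟩
  change objective x y (∑ j, VectorMeasure.dirac (z j) (α j), p) ≤ objective x y (Γ, r)
  by_cases hΓ : tvNorm Γ = ∞
  · simp [objective, hΓ]
  -- The index `none` carries the constant 1, whose moment is Γ(Ω): matching it preserves zero mass
  -- and costs the extra d atoms.
  let k : Option (Fin n) → Ω → ℝ := fun o => o.elim (fun _ => 1) k₀
  have hk' : ∀ o, Continuous (k o) := by
    rintro (_ | i)
    · exact continuous_const
    · exact hk i
  obtain ⟨z', α', hmom, hmass⟩ := exists_sum_dirac_moments_eq hk' Γ hΓ (N := N)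
    (by simpa [add_mul] using hN)
  have h0 : ∑ j, α' j = 0 := by
    have := isFiniteMeasure_variation Γ
    have h1 := hmom none
    have h2 : moments k Γ none = Γ Set.univ := by
      change VectorMeasure.integral Γ (fun _ => (1 : ℝ)) (ContinuousLinearMap.lsmul ℝ ℝ) = _
      simp
    rw [h2, hΓ0] at h1
    simpa [k] using h1
  have h3 := hmin (α', z', r) h0
  calc objective x y (∑ j, VectorMeasure.dirac (z j) (α j), p)
      ≤ ENNReal.ofReal (discreteObjective k₀ y (α, z, p)) := objective_sum_dirac_le x y z α p
    _ ≤ ENNReal.ofReal (discreteObjective k₀ y (α', z', r)) := ENNReal.ofReal_le_ofReal h3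
    _ ≤ objective x y (Γ, r) :=
        discreteObjective_le_objective x y (fun i => hmom (some i)) (ENNReal.ofReal_le_of_le_toReal hmass)

theorem mainTheorem9 (d n : ℕ) (Ω : Set (EnergyDistance.Space d)) (hΩ : IsCompact Ω)
    (x : Fin n → Ω) (hx : Function.Injective x) (y : Fin n → EnergyDistance.Space d) :
    ∃ (Γ : EnergyDistance.VMeas Ω) (p : EnergyDistance.Space d),
      EnergyDistance.IsSolution x y Γ p ∧
      ∃ m : ℕ, m ≤ n * d + d ∧
        ∃ (z : Fin m → Ω) (α : Fin m → EnergyDistance.Space d),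
          Γ = ∑ j, VectorMeasure.dirac (z j) (α j) ∧ ∑ j, α j = 0 := by
  have : CompactSpace Ω := isCompact_iff_compactSpace.1 hΩ
  rcases n.eq_zero_or_pos with rfl | hn
  -- Without data the objective vanishes at zero; Ω may be empty here, so no atoms are used.
  · refine ⟨0, 0, ⟨rfl, fun q _ => ?_⟩, 0, Nat.zero_le _, Fin.elim0, Fin.elim0, by simp, by simp⟩
    simp [EnergyDistance.objective, EnergyDistance.tvNorm, EnergyDistance.pairing]
  · obtain ⟨Γ, p, h, z, α, h1, h2⟩ := exists_isSolution_sum_dirac hn rfl x y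
    exact ⟨Γ, p, h, _, le_rfl, z, α, h1, h2⟩
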